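/- Let $X_1,X_2,\dots$ be independent real random variables with common distribution function $F$, let $S_n=X_1+\dots+X_n$ and $\overline F(x)=1-F(x)=P[X_1>x]$, and assume $\overline F(x)>0$ for all $x$. For $n\ge1$ put $a=a_n(s)=-\log\overline F(s)-\log n$ and $\mu_2(s)=\int_{|x|\le s}x^2\,dF(x)$. Let $t_n\to\infty$ be real constants. Suppose that $G(x)=P[|X_1|>x]$ is dominated varying, that is, $\liminf_{t\to\infty}G(\lambda t)/G(t)>0$ for some $\lambda>1$; that $S_n/t_n\to0$ in probability; and that $$\limsup_{n\to\infty}\ \sup_{s\ge t_n}\frac{n\,a_n(s)\,\mu_2(s)}{s^2}=0 .$$ Then the limit $\ell=\lim_{\lambda\downarrow1}\liminf_{t\to\infty}\overline F(\lambda t)/\overline F(t)\in[0,1]$ exists and, with $\gamma=-\log\ell\in[0,\infty]$ (where $-\log 0=\infty$, $e^{-\infty}=0$, $e^{\infty}=\infty$), $$e^{-\gamma}\le\liminf_{n\to\infty}\inf_{s\ge t_n}\frac{P[S_n>s]}{n\overline F(s)}\le\limsup_{n\to\infty}\sup_{s\ge t_n}\frac{P[S_n>s]}{n\overline F(s)}\le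 e^{\gamma}.$$ Moreover, if $\overline F$ is intermediate regularly varying, that is, $\overline F(\lambda t)/\overline F(t)\to1$ as $\lambda\to1$ and $t\to\infty$ jointly, then $$\lim_{n\to\infty}\sup_{s\ge t_n}\left|\frac{P[S_n>s]}{n\overline F(s)}-1\right|=0 .$$ -/

import Mathlib

open Filter Topology MeasureTheory ProbabilityTheory
open scoped ENNReal

noncomputable section

namespace LargeDev

/-- The right tail `1 - F(x) = P[X > x]` of a law `F` on the real line. -/
def tail (F : Measure ℝ) (x : ℝ) : ℝ := F.real (Set.Ioi x)

/-- The two-sided tail `P[|X| > x]` of a law `F` on the real line. -/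
def absTail (F : Measure ℝ) (x : ℝ) : ℝ := F.real {y | x < |y|}

/-- The truncated second moment, the integral of `x ^ 2` over `|x| ≤ t`. -/
def mu2 (F : Measure ℝ) (t : ℝ) : ℝ := ∫ x in {x : ℝ | |x| ≤ t}, x ^ 2 ∂F

/-- `ψ(s) = - log P[X > s]`. -/
def psi (F : Measure ℝ) (s : ℝ) : ℝ := -Real.log (tail F s)

/-- `a_n(s) = ψ(s) - log n`. -/
def aFun (F : Measure ℝ) (n : ℕ) (s : ℝ) : ℝ := psi F s - Real.log n

/-- The lower limit of `G (l * t) / G t` as `t → ∞`, as an extended nonnegative number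
(the functions `G` below are nonnegative). -/
def lowerIndex (G : ℝ → ℝ) (l : ℝ) : ℝ≥0∞ :=
  liminf (fun t : ℝ => ENNReal.ofReal (G (l * t) / G t)) atTop

/-- Dominated variation of a tail function: the lower limit of `G (l * t) / G t` is positive
for some `l > 1`. -/
def DominatedVarying (G : ℝ → ℝ) : Prop := ∃ l : ℝ, 1 < l ∧ 0 < lowerIndex G l

/-- Intermediate regular variation of a tail function: `G (l * t) / G t → 1` as `l → 1` and
`t → ∞` jointly. -/
def IntermediateRegularlyVarying (G : ℝ → ℝ) : Prop :=
  Tendsto (fun p : ℝ × ℝ => G (p.1 * p.2) / G p.2) (𝓝 1 ×ˢ atTop) (𝓝 1)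

/-- The partial sum `S_n` of the first `n` members of the sequence `X`. -/
def partialSum {Ω : Type*} (X : ℕ → Ω → ℝ) (n : ℕ) (ω : Ω) : ℝ := ∑ i ∈ Finset.range n, X i ω

/-- The ratio `P[S_n > s] / (n P[X > s])`, where `F` is the law of `X`. -/
def ratio {Ω : Type*} [MeasurableSpace Ω] (P : Measure Ω) (F : Measure ℝ) (X : ℕ → Ω → ℝ)
    (n : ℕ) (s : ℝ) : ℝ :=
  P.real {ω | s < partialSum X n ω} / (n * tail F s)

end LargeDev

end

namespace LargeDev

/-! This is the principle of one big jump: for `s ≥ t n`, the sum exceeds `s` essentially because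
one summand does, while the others add up to `o(s)`.

Lower bound (`eventually_mul_le_ratio`): if `X i > l * s` and the rest is at most `(l - 1) * s` in
modulus, then `S_n > s`. The rest is independent of `X i`, and by the weak law two big jumps are
negligible. So the ratio is asymptotically at least any `c` with `c * tail F x ≤ tail F (l * x)` for
large `x`.

Upper bound (`eventually_ratio_le`): split `S_n > s` into a summand above `s / l`, a summand above
`s / 8` with the rest still large, and all summands at most `s / 8`. The first part has probability
at most about `c⁻¹ * n * tail F s`; the second is smaller by independence. The third is bounded by
an exponential Markov inequality with `h = 2 * a / s`, where `exp (-a) = n * tail F s`; the moment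
condition, the weak law and a Potter-type bound make the exponent at most `-a + (1 - a / 2)` with `a
→ ∞`.

Letting `l` decrease to 1 turns the admissible `c` into `ℓ`; if `ℓ = 0` both bounds are trivial. -/

/-! ### Bonferroni bound and the one-big-jump estimate. -/

/-- Bonferroni: overlaps are controlled by the `A i` alone, so the `B i` may depend on each other
arbitrarily. -/
theorem mul_sub_le_measureReal_iUnion_inter {Ω : Type*} [MeasurableSpace Ω] {P : Measure Ω}
    [IsProbabilityMeasure P] {A B : ℕ → Set Ω} {p q : ℝ} (m : ℕ)
    (hA : ∀ i < m, NullMeasurableSet (A i) P) (hB : ∀ i < m, NullMeasurableSet (B i) P)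
    (hAA : ∀ i < m, ∀ j < m, i ≠ j → P.real (A i ∩ A j) ≤ p ^ 2)
    (hAB : ∀ i < m, p * q ≤ P.real (A i ∩ B i)) :
    m * p * (q - m * p) ≤ P.real (⋃ i ∈ Finset.range m, A i ∩ B i) := by
  induction m with
  | zero => simp
  | succ m ih =>
    have ih := ih (fun i hi => hA i (by omega)) (fun i hi => hB i (by omega))
      (fun i hi j hj => hAA i (by omega) j (by omega)) (fun i hi => hAB i (by omega))
    have hunion : (⋃ i ∈ Finset.range (m + 1), A i ∩ B i)
        = (⋃ i ∈ Finset.range m, A i ∩ B i) ∪ (A m ∩ B m) := by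
      rw [Finset.range_add_one, Finset.set_biUnion_insert, Set.union_comm]
    have hadd := measureReal_union_add_inter₀ (μ := P) (s := ⋃ i ∈ Finset.range m, A i ∩ B i)
      ((hA m (by omega)).inter (hB m (by omega))) (measure_ne_top _ _) (measure_ne_top _ _)
    have hinter : P.real ((⋃ i ∈ Finset.range m, A i ∩ B i) ∩ (A m ∩ B m)) ≤ m * p ^ 2 := by
      calc P.real ((⋃ i ∈ Finset.range m, A i ∩ B i) ∩ (A m ∩ B m))
          ≤ P.real (⋃ i ∈ Finset.range m, A i ∩ A m) := by
            refine measureReal_mono ?_ (measure_ne_top _ _)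
            rintro ω ⟨h1, h2⟩
            simp only [Set.mem_iUnion] at h1 ⊢
            obtain ⟨i, hi, h⟩ := h1
            exact ⟨i, hi, h.1, h2.1⟩
        _ ≤ ∑ i ∈ Finset.range m, P.real (A i ∩ A m) := measureReal_biUnion_finset_le _ _
        _ ≤ ∑ _i ∈ Finset.range m, p ^ 2 := by
            refine Finset.sum_le_sum fun i hi => ?_
            have := Finset.mem_range.1 hi
            exact hAA i (by omega) m (by omega) (by omega)
        _ = m * p ^ 2 := by simp
    have h3 := hAB m (by omega)
    rw [hunion]
    push_cast
    nlinarith [mul_nonneg (Nat.cast_nonneg (α := ℝ) m) (sq_nonneg p), sq_nonneg p]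

theorem one_sub_le_measureReal_of_union {Ω : Type*} [MeasurableSpace Ω] {P : Measure Ω}
    [IsProbabilityMeasure P] {U V W : Set Ω} (h : ∀ ω, ω ∈ U ∨ ω ∈ V ∨ ω ∈ W) :
    1 - P.real V - P.real W ≤ P.real U := by
  have h1 : P.real (U ∪ (V ∪ W)) = 1 := by
    rw [show U ∪ (V ∪ W) = Set.univ from Set.eq_univ_of_forall h, probReal_univ]
  have h2 := measureReal_union_le (μ := P) U (V ∪ W)
  have h3 := measureReal_union_le (μ := P) V W
  linarith

theorem HasLaw.measureReal_preimage {Ω : Type*} [MeasurableSpace Ω] {P : Measure Ω}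
    {F : Measure ℝ} {Y : Ω → ℝ} (hY : HasLaw Y F P) {A : Set ℝ} (hA : MeasurableSet A) :
    P.real (Y ⁻¹' A) = F.real A := by
  rw [← hY.map_eq, map_measureReal_apply_of_aemeasurable hY.aemeasurable hA]

theorem aemeasurable_partialSum {Ω : Type*} [MeasurableSpace Ω] {P : Measure Ω}
    {X : ℕ → Ω → ℝ} (hX : ∀ i, AEMeasurable (X i) P) (n : ℕ) :
    AEMeasurable (partialSum X n) P := by
  unfold partialSum
  fun_prop

theorem partialSum_sub_eq_sum_erase {Ω : Type*} (X : ℕ → Ω → ℝ) {n i : ℕ} (hi : i < n) :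
    (fun ω => partialSum X n ω - X i ω) = ∑ j ∈ (Finset.range n).erase i, X j := by
  ext ω
  rw [Finset.sum_apply, partialSum, ← Finset.add_sum_erase _ _ (Finset.mem_range.2 hi)]
  ring

theorem indepFun_partialSum_sub {Ω : Type*} [MeasurableSpace Ω] {P : Measure Ω}
    {X : ℕ → Ω → ℝ} (hindep : iIndepFun X P) (hX : ∀ i, AEMeasurable (X i) P) {n i : ℕ}
    (hi : i < n) : IndepFun (fun ω => partialSum X n ω - X i ω) (X i) P := by
  rw [partialSum_sub_eq_sum_erase X hi]
  exact hindep.indepFun_finsetSum_of_notMem₀ hX (Finset.notMem_erase i _)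

theorem IndepFun.measureReal_inter_preimage {Ω : Type*} [MeasurableSpace Ω] {P : Measure Ω}
    {Y Z : Ω → ℝ} (h : IndepFun Y Z P) {A B : Set ℝ} (hA : MeasurableSet A)
    (hB : MeasurableSet B) : P.real (Y ⁻¹' A ∩ Z ⁻¹' B) = P.real (Y ⁻¹' A) * P.real (Z ⁻¹' B) := by
  simp only [measureReal_def, h.measure_inter_preimage_eq_mul A B hA hB, ENNReal.toReal_mul]

/-- A lower bound for the probability that one large summand decides the event `E`, the sum of
the other summands being in `B`. -/
theorem mul_sub_le_measureReal_of_big_jump {Ω : Type*} [MeasurableSpace Ω] {P : Measure Ω}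
    [IsProbabilityMeasure P] {F : Measure ℝ} {X : ℕ → Ω → ℝ} (hindep : iIndepFun X P)
    (hlaw : ∀ i, HasLaw (X i) F P) {A B : Set ℝ} (hA : MeasurableSet A) (hB : MeasurableSet B)
    {m n : ℕ} (hmn : m ≤ n) {q : ℝ}
    (hq : ∀ i < n, q ≤ P.real {ω | partialSum X n ω - X i ω ∈ B}) {E : Set Ω}
    (hE : ∀ ω, ∀ i < n, X i ω ∈ A → partialSum X n ω - X i ω ∈ B → ω ∈ E) :
    m * F.real A * (q - m * F.real A) ≤ P.real E := by
  have hX : ∀ i, AEMeasurable (X i) P := fun i => (hlaw i).aemeasurable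
  refine (mul_sub_le_measureReal_iUnion_inter (P := P) (A := fun i => X i ⁻¹' A)
    (B := fun i => (fun ω => partialSum X n ω - X i ω) ⁻¹' B) m
    (fun i _ => (hX i).nullMeasurableSet_preimage hA)
    (fun i _ => ((aemeasurable_partialSum hX n).sub (hX i)).nullMeasurableSet_preimage hB)
    ?_ ?_).trans (measureReal_mono ?_)
  · intro i hi j hj hij
    rw [IndepFun.measureReal_inter_preimage (hindep.indepFun hij) hA hA,
      HasLaw.measureReal_preimage (hlaw i) hA, HasLaw.measureReal_preimage (hlaw j) hA, sq]
  · intro i hi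
    rw [IndepFun.measureReal_inter_preimage
      (indepFun_partialSum_sub hindep hX (hi.trans_le hmn)).symm hA hB,
      HasLaw.measureReal_preimage (hlaw i) hA]
    exact mul_le_mul_of_nonneg_left (hq i (hi.trans_le hmn)) measureReal_nonneg
  · intro ω hω
    simp only [Set.mem_iUnion, Finset.mem_range] at hω
    obtain ⟨i, hi, h1, h2⟩ := hω
    exact hE ω i (hi.trans_le hmn) h1 h2

/-! ### Consequences of the weak law, uniformly in `s ≥ t n`. -/

theorem eventually_forall_ge_of_eventually {p : ℝ → Prop} (h : ∀ᶠ s in atTop, p s) {t : ℕ → ℝ}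
    (ht : Tendsto t atTop atTop) : ∀ᶠ n in atTop, ∀ s, t n ≤ s → p s := by
  obtain ⟨s₀, hs₀⟩ := eventually_atTop.1 h
  filter_upwards [ht.eventually_ge_atTop s₀] with n hn s hs
  exact hs₀ s (hn.trans hs)

theorem measurableSet_lt_abs (x : ℝ) : MeasurableSet {y : ℝ | x < |y|} :=
  measurableSet_lt measurable_const measurable_norm

theorem tendsto_absTail_atTop (F : Measure ℝ) [IsProbabilityMeasure F] :
    Tendsto (absTail F) atTop (𝓝 0) := by
  have h := (isTightMeasureSet_iff_tendsto_measure_norm_gt (S := {F})).1 isTightMeasureSet_singleton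
  simp only [Set.mem_singleton_iff, iSup_iSup_eq_left, Real.norm_eq_abs] at h
  exact (ENNReal.tendsto_toReal_zero_iff fun _ => measure_ne_top _ _).2 h

theorem absTail_nonneg (F : Measure ℝ) (x : ℝ) : 0 ≤ absTail F x := measureReal_nonneg

theorem tail_le_absTail (F : Measure ℝ) [IsProbabilityMeasure F] (x : ℝ) :
    tail F x ≤ absTail F x :=
  measureReal_mono (fun y hy => lt_of_lt_of_le hy (le_abs_self y)) (measure_ne_top _ _)

theorem tail_antitone (F : Measure ℝ) [IsProbabilityMeasure F] : Antitone (tail F) :=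
  fun _ _ h => measureReal_mono (Set.Ioi_subset_Ioi h) (measure_ne_top _ _)

theorem tail_nonneg (F : Measure ℝ) (x : ℝ) : 0 ≤ tail F x := measureReal_nonneg

theorem tail_le_one (F : Measure ℝ) [IsProbabilityMeasure F] (x : ℝ) : tail F x ≤ 1 :=
  measureReal_le_one

theorem eventually_absTail_le (F : Measure ℝ) [IsProbabilityMeasure F] {t : ℕ → ℝ}
    (ht : Tendsto t atTop atTop) {ε η : ℝ} (hε : 0 < ε) (hη : 0 < η) :
    ∀ᶠ n in atTop, ∀ s, t n ≤ s → absTail F (ε * s) ≤ η :=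
  eventually_forall_ge_of_eventually (((tendsto_absTail_atTop F).comp
    (tendsto_id.const_mul_atTop hε)).eventually_le_const hη) ht

theorem eventually_measureReal_abs_partialSum_le {Ω : Type*} [MeasurableSpace Ω] {P : Measure Ω}
    [IsProbabilityMeasure P] {X : ℕ → Ω → ℝ} {t : ℕ → ℝ} (ht : Tendsto t atTop atTop)
    (hprob : TendstoInMeasure P (fun n ω => partialSum X n ω / t n) atTop (fun _ => 0))
    {ε η : ℝ} (hε : 0 < ε) (hη : 0 < η) :
    ∀ᶠ n in atTop, ∀ s, t n ≤ s → P.real {ω | ε * s < |partialSum X n ω|} ≤ η := by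
  filter_upwards [ht.eventually_gt_atTop 0,
    (tendstoInMeasure_iff_measureReal_norm.1 hprob ε hε).eventually_le_const hη] with n hn h s hs
  refine le_trans (measureReal_mono (fun ω hω => ?_) (measure_ne_top _ _)) h
  simp only [Set.mem_ofPred_eq, sub_zero, Real.norm_eq_abs, abs_div, abs_of_pos hn] at hω ⊢
  rw [le_div_iff₀ hn]
  nlinarith

theorem HasLaw.measureReal_lt_abs {Ω : Type*} [MeasurableSpace Ω] {P : Measure Ω}
    {F : Measure ℝ} {Y : Ω → ℝ} (hY : HasLaw Y F P) (x : ℝ) :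
    P.real {ω | x < |Y ω|} = absTail F x :=
  HasLaw.measureReal_preimage hY (measurableSet_lt_abs x)

theorem HasLaw.measureReal_lt {Ω : Type*} [MeasurableSpace Ω] {P : Measure Ω}
    {F : Measure ℝ} {Y : Ω → ℝ} (hY : HasLaw Y F P) (x : ℝ) :
    P.real {ω | x < Y ω} = tail F x :=
  HasLaw.measureReal_preimage hY measurableSet_Ioi

theorem eventually_measureReal_abs_partialSum_sub_le {Ω : Type*} [MeasurableSpace Ω]
    {P : Measure Ω} [IsProbabilityMeasure P] {F : Measure ℝ} [IsProbabilityMeasure F]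
    {X : ℕ → Ω → ℝ} {t : ℕ → ℝ} (hlaw : ∀ i, HasLaw (X i) F P) (ht : Tendsto t atTop atTop)
    (hprob : TendstoInMeasure P (fun n ω => partialSum X n ω / t n) atTop (fun _ => 0))
    {ε η : ℝ} (hε : 0 < ε) (hη : 0 < η) :
    ∀ᶠ n in atTop, ∀ s, t n ≤ s → ∀ i,
      P.real {ω | ε * s < |partialSum X n ω - X i ω|} ≤ η := by
  filter_upwards [eventually_absTail_le F ht (half_pos hε) (half_pos hη),
    eventually_measureReal_abs_partialSum_le ht hprob (half_pos hε) (half_pos hη)]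
    with n h1 h2 s hs i
  have h3 : P.real {ω | ε * s < |partialSum X n ω - X i ω|}
      ≤ P.real ({ω | ε / 2 * s < |partialSum X n ω|} ∪ {ω | ε / 2 * s < |X i ω|}) := by
    refine measureReal_mono (fun ω hω => ?_) (measure_ne_top _ _)
    by_contra hcon
    simp only [Set.mem_union, Set.mem_ofPred_eq, not_or, not_lt] at hcon hω
    have := abs_sub (partialSum X n ω) (X i ω)
    linarith [hcon.1, hcon.2]
  have h4 := measureReal_union_le (μ := P) {ω | ε / 2 * s < |partialSum X n ω|}
    {ω | ε / 2 * s < |X i ω|}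
  rw [HasLaw.measureReal_lt_abs (hlaw i)] at h4
  linarith [h1 s hs, h2 s hs]

theorem one_sub_le_measureReal_abs_le {Ω : Type*} [MeasurableSpace Ω] {P : Measure Ω}
    [IsProbabilityMeasure P] {Y : Ω → ℝ} {x η : ℝ} (h : P.real {ω | x < |Y ω|} ≤ η) :
    1 - η ≤ P.real {ω | Y ω ∈ {y : ℝ | |y| ≤ x}} := by
  have := one_sub_le_measureReal_of_union (P := P) (U := {ω | Y ω ∈ {y : ℝ | |y| ≤ x}})
    (V := {ω | x < |Y ω|}) (W := ∅) (fun ω => (le_or_gt |Y ω| x).imp id Or.inl)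
  simp only [measureReal_empty] at this
  linarith

/-- If `n * p` stayed above `η`, a jump larger than `ε * s` not cancelled by the other summands
would keep `|S_n| > ε / 2 * s` with probability bounded below, against the weak law. -/
theorem eventually_mul_absTail_le {Ω : Type*} [MeasurableSpace Ω]
    {P : Measure Ω} [IsProbabilityMeasure P] {F : Measure ℝ} [IsProbabilityMeasure F]
    {X : ℕ → Ω → ℝ} {t : ℕ → ℝ} (hindep : iIndepFun X P) (hlaw : ∀ i, HasLaw (X i) F P)
    (ht : Tendsto t atTop atTop)
    (hprob : TendstoInMeasure P (fun n ω => partialSum X n ω / t n) atTop (fun _ => 0))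
    {ε η : ℝ} (hε : 0 < ε) (hη : 0 < η) :
    ∀ᶠ n : ℕ in atTop, ∀ s, t n ≤ s → n * absTail F (ε * s) ≤ η := by
  wlog hη4 : η ≤ 1 / 4 generalizing η
  · filter_upwards [this (η := 1 / 4) (by norm_num) le_rfl] with n hn s hs
    linarith [hn s hs]
  filter_upwards [eventually_absTail_le F ht hε (half_pos hη),
    eventually_measureReal_abs_partialSum_le ht hprob (half_pos hε) (show 0 < η / 5 by positivity),
    eventually_measureReal_abs_partialSum_sub_le hlaw ht hprob (half_pos hε)
      (show (0 : ℝ) < 1 / 4 by norm_num)] with n h1 h2 h3 s hs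
  by_contra! hcon
  have hp : 0 < absTail F (ε * s) := by
    rcases (absTail_nonneg F (ε * s)).eq_or_lt with h | h
    · rw [← h] at hcon; linarith
    · exact h
  set p := absTail F (ε * s) with hp_def
  -- Only `m = ⌊η / p⌋₊` of the `n` possible jumps are used: since `p ≤ η / 2`, this puts `m * p` in
  -- `(η / 2, η]`, where the quadratic bound `m * p * (3 / 4 - m * p)` is at least `η / 4 > η / 5`.
  have hm1 : (⌊η / p⌋₊ : ℝ) * p ≤ η := by
    rw [← le_div_iff₀ hp]; exact Nat.floor_le (by positivity)
  have hm2 : η < (⌊η / p⌋₊ + 1 : ℝ) * p := by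
    rw [← div_lt_iff₀ hp]; exact Nat.lt_floor_add_one _
  have hmn : ⌊η / p⌋₊ ≤ n := by
    refine Nat.floor_le_of_le ?_
    rw [div_le_iff₀ hp]; exact hcon.le
  have key := mul_sub_le_measureReal_of_big_jump hindep hlaw (measurableSet_lt_abs (ε * s))
    (measurableSet_le (measurable_norm (α := ℝ)) (measurable_const (a := ε / 2 * s))) hmn
    (q := 1 - 1 / 4) (fun i _ => one_sub_le_measureReal_abs_le (h3 s hs i))
    (E := {ω | ε / 2 * s < |partialSum X n ω|}) (fun ω i _ hA hB => by
      simp only [Set.mem_ofPred_eq, Real.norm_eq_abs] at hA hB ⊢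
      have := abs_sub_abs_le_abs_sub (X i ω) (partialSum X n ω)
      rw [abs_sub_comm] at this
      linarith)
  change (⌊η / p⌋₊ : ℝ) * p * (1 - 1 / 4 - (⌊η / p⌋₊ : ℝ) * p) ≤ _ at key
  have h1' := h1 s hs
  have h2' := h2 s hs
  nlinarith

theorem exp_neg_aFun (F : Measure ℝ) {n : ℕ} (hn : 0 < n) {s : ℝ} (hs : 0 < tail F s) :
    Real.exp (-aFun F n s) = n * tail F s := by
  have hn' : (0 : ℝ) < n := Nat.cast_pos.2 hn
  rw [aFun, psi, show -(-Real.log (tail F s) - Real.log n) = Real.log n + Real.log (tail F s) by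
    ring, Real.exp_add, Real.exp_log hn', Real.exp_log hs]

theorem eventually_le_aFun {F : Measure ℝ} [IsProbabilityMeasure F]
    {t : ℕ → ℝ} (hpos : ∀ x, 0 < tail F x)
    (hG : ∀ η : ℝ, 0 < η → ∀ᶠ n : ℕ in atTop, ∀ s, t n ≤ s → n * absTail F s ≤ η) (M : ℝ) :
    ∀ᶠ n : ℕ in atTop, ∀ s, t n ≤ s → M ≤ aFun F n s := by
  filter_upwards [hG (Real.exp (-M)) (Real.exp_pos _), eventually_gt_atTop 0] with n hn hn0 s hs
  have h := (mul_le_mul_of_nonneg_left (tail_le_absTail F s) (Nat.cast_nonneg n)).trans (hn s hs)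
  rw [← exp_neg_aFun F hn0 (hpos s), Real.exp_le_exp] at h
  linarith

theorem eventually_forall_le_of_limsup_iSup_eq_zero {f : ℕ → ℝ → ℝ} {t : ℕ → ℝ}
    (h : limsup (fun n : ℕ => ⨆ s ∈ Set.Ici (t n), ((f n s : ℝ) : EReal)) atTop = 0)
    {η : ℝ} (hη : 0 < η) : ∀ᶠ n : ℕ in atTop, ∀ s, t n ≤ s → f n s ≤ η := by
  have h1 : limsup (fun n : ℕ => ⨆ s ∈ Set.Ici (t n), ((f n s : ℝ) : EReal)) atTop < (η : EReal) := by
    rw [h]; exact_mod_cast hη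
  filter_upwards [eventually_lt_of_limsup_lt h1] with n hn s hs
  have h2 : ((f n s : ℝ) : EReal) ≤ ⨆ s ∈ Set.Ici (t n), ((f n s : ℝ) : EReal) :=
    le_iSup₂ (f := fun s (_ : s ∈ Set.Ici (t n)) => ((f n s : ℝ) : EReal)) s hs
  exact_mod_cast (h2.trans_lt hn).le

/-! ### The truncated mean is negligible: `n * |truncMean F s|` is small against `s`. -/

/-- The truncated mean, the integral of `x` over `|x| ≤ t`. -/
noncomputable def truncMean (F : Measure ℝ) (t : ℝ) : ℝ := ∫ x in {x : ℝ | |x| ≤ t}, x ∂F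

theorem measurableSet_abs_le (s : ℝ) : MeasurableSet {x : ℝ | |x| ≤ s} :=
  measurableSet_le measurable_norm measurable_const

theorem mu2_nonneg (F : Measure ℝ) (s : ℝ) : 0 ≤ mu2 F s :=
  integral_nonneg fun x => sq_nonneg x

theorem measureReal_le_abs_sum_sub_le {Ω : Type*} [MeasurableSpace Ω] {P : Measure Ω}
    [IsProbabilityMeasure P] {F : Measure ℝ} {X : ℕ → Ω → ℝ} (hindep : iIndepFun X P)
    (hlaw : ∀ i, HasLaw (X i) F P) {g : ℝ → ℝ} (hg : Measurable g) {C : ℝ}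
    (hC : ∀ x, |g x| ≤ C) (n : ℕ) {c : ℝ} (hc : 0 < c) :
    P.real {ω | c ≤ |∑ i ∈ Finset.range n, g (X i ω) - n * ∫ x, g x ∂F|}
      ≤ n * (∫ x, g x ^ 2 ∂F) / c ^ 2 := by
  have hmem : ∀ i, MemLp (fun ω => g (X i ω)) 2 P := fun i =>
    MemLp.of_bound (hg.comp_aemeasurable (hlaw i).aemeasurable).aestronglyMeasurable C
      (Eventually.of_forall fun ω => hC _)
  have hmean : ∀ i, ∫ ω, g (X i ω) ∂P = ∫ x, g x ∂F := fun i =>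
    (hlaw i).integral_comp hg.aestronglyMeasurable
  have hsq : ∀ i, ∫ ω, g (X i ω) ^ 2 ∂P = ∫ x, g x ^ 2 ∂F := fun i =>
    (hlaw i).integral_comp (f := fun x => g x ^ 2) (hg.pow_const 2).aestronglyMeasurable
  have hvar : variance (∑ i ∈ Finset.range n, fun ω => g (X i ω)) P ≤ n * ∫ x, g x ^ 2 ∂F := by
    rw [IndepFun.variance_sum (fun i _ => hmem i)
      (fun i _ j _ hij => (hindep.indepFun hij).comp hg hg)]
    calc ∑ i ∈ Finset.range n, variance (fun ω => g (X i ω)) P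
        ≤ ∑ _i ∈ Finset.range n, ∫ x, g x ^ 2 ∂F := by
          refine Finset.sum_le_sum fun i _ => ?_
          rw [← hsq i]
          exact variance_le_expectation_sq (hmem i).aestronglyMeasurable
      _ = n * ∫ x, g x ^ 2 ∂F := by simp
  have hint : ∫ ω, (∑ i ∈ Finset.range n, fun ω => g (X i ω)) ω ∂P = n * ∫ x, g x ∂F := by
    simp only [Finset.sum_apply]
    rw [integral_finsetSum _ fun i _ => (hmem i).integrable (by norm_num)]
    simp [hmean]
  have hcheb := meas_ge_le_variance_div_sq (memLp_finsetSum' (Finset.range n) fun i _ => hmem i) hc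
  rw [hint] at hcheb
  simp only [Finset.sum_apply] at hcheb
  refine (ENNReal.toReal_le_of_le_ofReal (div_nonneg (variance_nonneg _ _) (sq_nonneg c))
    hcheb).trans ?_
  gcongr

theorem abs_indicator_abs_le_id_le {s : ℝ} (hs : 0 ≤ s) (x : ℝ) :
    |Set.indicator {x : ℝ | |x| ≤ s} id x| ≤ s := by
  by_cases hx : |x| ≤ s
  · rw [Set.indicator_of_mem (by exact hx)]; exact hx
  · rw [Set.indicator_of_notMem (by exact hx)]; simpa using hs

/-- The truncated sum is near `n * truncMean F s` by Chebyshev, equals `S_n` unless some `|X i| >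
s`, and `S_n` is small. A large centring would make three events of probability at most `1 / 4`
cover the whole space. -/
theorem mul_abs_truncMean_lt {Ω : Type*} [MeasurableSpace Ω] {P : Measure Ω}
    [IsProbabilityMeasure P] {F : Measure ℝ} {X : ℕ → Ω → ℝ} (hindep : iIndepFun X P)
    (hlaw : ∀ i, HasLaw (X i) F P) {n : ℕ} {s η : ℝ} (hs : 0 < s) (hη : 0 < η)
    (hG : n * absTail F s ≤ 1 / 4) (hmu : n * mu2 F s / s ^ 2 ≤ (η / 2) ^ 2 / 4)
    (hS : P.real {ω | η / 2 * s < |partialSum X n ω|} ≤ 1 / 4) :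
    n * |truncMean F s| < η * s := by
  set g : ℝ → ℝ := Set.indicator {x : ℝ | |x| ≤ s} id with hg
  have hgm : Measurable g := measurable_id.indicator (measurableSet_abs_le s)
  have hg1 : ∫ x, g x ∂F = truncMean F s := integral_indicator (measurableSet_abs_le s)
  have hg2 : ∫ x, g x ^ 2 ∂F = mu2 F s := by
    rw [mu2, ← integral_indicator (measurableSet_abs_le s)]
    congr 1 with x
    by_cases hx : x ∈ {x : ℝ | |x| ≤ s}
    · simp [hg, Set.indicator_of_mem hx]
    · simp [hg, Set.indicator_of_notMem hx]
  have hc : 0 < η / 2 * s := by positivity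
  have hcheb := measureReal_le_abs_sum_sub_le hindep hlaw hgm (abs_indicator_abs_le_id_le hs.le)
    n hc
  rw [hg1, hg2] at hcheb
  have hcheb' : n * mu2 F s / (η / 2 * s) ^ 2 ≤ 1 / 4 := by
    rw [div_le_iff₀ (by positivity)] at hmu ⊢
    linarith
  have hbig : P.real (⋃ i ∈ Finset.range n, {ω | s < |X i ω|}) ≤ 1 / 4 := by
    refine (measureReal_biUnion_finset_le _ _).trans ?_
    simpa [HasLaw.measureReal_lt_abs (hlaw _)] using hG
  by_contra! hcon
  have hall := one_sub_le_measureReal_of_union (P := P) (U := ⋃ i ∈ Finset.range n, {ω | s < |X i ω|})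
    (V := {ω | η / 2 * s ≤ |∑ i ∈ Finset.range n, g (X i ω) - n * truncMean F s|})
    (W := {ω | η / 2 * s < |partialSum X n ω|}) (fun ω => by
      by_contra! h
      obtain ⟨h1, h2, h3⟩ := h
      simp only [Set.mem_iUnion, Finset.mem_range, Set.mem_ofPred_eq, not_exists, not_lt,
        not_le] at h1 h2 h3
      have hsum : ∑ i ∈ Finset.range n, g (X i ω) = partialSum X n ω := by
        refine Finset.sum_congr rfl fun i hi => ?_
        exact Set.indicator_of_mem (by exact h1 i (Finset.mem_range.1 hi)) _
      rw [hsum] at h2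
      have h4 := abs_sub_abs_le_abs_sub (n * truncMean F s) (partialSum X n ω)
      rw [abs_sub_comm, abs_mul, Nat.abs_cast] at h4
      linarith)
  linarith

/-! ### Exponential bound when no summand exceeds `b`. -/

theorem measureReal_lt_partialSum_le_exp_mul_pow {Ω : Type*} [MeasurableSpace Ω] {P : Measure Ω}
    [IsProbabilityMeasure P] {F : Measure ℝ} {X : ℕ → Ω → ℝ} (hindep : iIndepFun X P)
    (hlaw : ∀ i, HasLaw (X i) F P) (n : ℕ) {s b h : ℝ} (hh : 0 ≤ h) :
    P.real {ω | s < partialSum X n ω ∧ ∀ i < n, X i ω ≤ b}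
      ≤ Real.exp (-(h * s)) *
        (∫ x, Set.indicator (Set.Iic b) (fun x => Real.exp (h * x)) x ∂F) ^ n := by
  set f : ℝ → ℝ := Set.indicator (Set.Iic b) (fun x => Real.exp (h * x)) with hf
  have hfm : Measurable f := by
    refine Measurable.indicator ?_ measurableSet_Iic
    fun_prop
  have hf0 : ∀ x, 0 ≤ f x := fun x => Set.indicator_nonneg (fun _ _ => (Real.exp_pos _).le) x
  have hfb : ∀ x, f x ≤ Real.exp (h * b) := by
    intro x
    by_cases hx : x ≤ b
    · rw [hf, Set.indicator_of_mem (by exact hx)]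
      exact Real.exp_le_exp.2 (mul_le_mul_of_nonneg_left hx hh)
    · rw [hf, Set.indicator_of_notMem (by exact hx)]
      exact (Real.exp_pos _).le
  have hX : ∀ i, AEMeasurable (X i) P := fun i => (hlaw i).aemeasurable
  have hint : ∫ ω, ∏ i : Fin n, f (X i ω) ∂P = (∫ x, f x ∂F) ^ n := by
    rw [iIndepFun.integral_fun_prod_comp (f := fun _ : Fin n => f)
      (hindep.precomp Fin.val_injective) (fun i => hX i)
      (fun i => hfm.aestronglyMeasurable)]
    have : ∀ i, ∫ ω, f (X i ω) ∂P = ∫ x, f x ∂F := fun i =>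
      (hlaw i).integral_comp hfm.aestronglyMeasurable
    simp [this]
  have hinteg : Integrable (fun ω => ∏ i : Fin n, f (X i ω)) P := by
    refine Integrable.of_bound (C := Real.exp (h * b) ^ n) ?_ (Eventually.of_forall fun ω => ?_)
    · exact (Finset.aemeasurable_fun_prod (Finset.univ : Finset (Fin n)) fun i _ =>
        hfm.comp_aemeasurable (hX i)).aestronglyMeasurable
    · rw [Real.norm_of_nonneg (Finset.prod_nonneg fun i _ => hf0 _)]
      refine (Finset.prod_le_prod (fun i _ => hf0 _) fun i _ => hfb _).trans ?_
      simp
  have hmarkov := mul_meas_ge_le_integral_of_nonneg (μ := P)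
    (f := fun ω => ∏ i : Fin n, f (X i ω))
    (Eventually.of_forall fun ω => Finset.prod_nonneg fun i _ => hf0 (X i ω)) hinteg
    (Real.exp (h * s))
  rw [hint] at hmarkov
  rw [Real.exp_neg, ← div_eq_inv_mul, le_div_iff₀' (Real.exp_pos _)]
  refine le_trans (mul_le_mul_of_nonneg_left (measureReal_mono ?_ (measure_ne_top _ _))
    (Real.exp_pos _).le) hmarkov
  rintro ω ⟨h1, h2⟩
  have hprod : ∏ i : Fin n, f (X i ω) = Real.exp (h * partialSum X n ω) := by
    rw [partialSum, Finset.mul_sum, Real.exp_sum, ← Fin.prod_univ_eq_prod_range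
      (fun i => Real.exp (h * X i ω))]
    exact Finset.prod_congr rfl fun i _ => Set.indicator_of_mem (by exact h2 i i.2) _
  change Real.exp (h * s) ≤ ∏ i : Fin n, f (X i ω)
  rw [hprod, Real.exp_le_exp]
  exact mul_le_mul_of_nonneg_left h1.le hh

theorem exp_le_one_add_add_sq {u : ℝ} (hu : u ≤ 1) : Real.exp u ≤ 1 + u + u ^ 2 := by
  rcases le_or_gt (-1) u with h | h
  · have := Real.abs_exp_sub_one_sub_id_le (x := u) (abs_le.2 ⟨h, hu⟩)
    linarith [(abs_le.1 this).2]
  · have : Real.exp u ≤ 1 := Real.exp_le_one_iff.2 (by linarith)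
    nlinarith

/-- A pointwise bound, integrated: the quadratic estimate of `exp` serves where `h * x ≤ 1` and `|x|
≤ s`, the constant `exp (h * b)` where `h⁻¹ < x ≤ b`, and 1 where `x < -s`. -/
theorem integral_indicator_Iic_exp_le (F : Measure ℝ) [IsProbabilityMeasure F] {s b h : ℝ}
    (hh : 0 < h) (hs : 0 ≤ s) (hbs : b ≤ s) :
    ∫ x, Set.indicator (Set.Iic b) (fun x => Real.exp (h * x)) x ∂F
      ≤ 1 + (h * truncMean F s + h ^ 2 * mu2 F s + Real.exp (h * b) * tail F h⁻¹) := by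
  set D : Set ℝ := {x : ℝ | |x| ≤ s} with hD
  have hDm : MeasurableSet D := measurableSet_abs_le s
  have i1 : Integrable (D.indicator fun x => x) F :=
    Integrable.of_bound (measurable_id.indicator hDm).aestronglyMeasurable s
      (Eventually.of_forall fun x => abs_indicator_abs_le_id_le hs x)
  have i2 : Integrable (D.indicator fun x => x ^ 2) F := by
    refine Integrable.of_bound ((measurable_id.pow_const 2).indicator hDm).aestronglyMeasurable
      (s ^ 2) (Eventually.of_forall fun x => ?_)
    by_cases hx : x ∈ D
    · rw [Set.indicator_of_mem hx, Real.norm_of_nonneg (sq_nonneg _)]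
      exact sq_le_sq' (abs_le.1 hx).1 (abs_le.1 hx).2
    · rw [Set.indicator_of_notMem hx, norm_zero]; positivity
  have i3 : Integrable ((Set.Ioi h⁻¹).indicator fun _ => (1 : ℝ)) F :=
    (integrable_const 1).indicator measurableSet_Ioi
  have hrhs : ∫ x, (1 + (h * D.indicator (fun x => x) x + h ^ 2 * D.indicator (fun x => x ^ 2) x
      + Real.exp (h * b) * (Set.Ioi h⁻¹).indicator (fun _ => (1 : ℝ)) x)) ∂F
      = 1 + (h * truncMean F s + h ^ 2 * mu2 F s + Real.exp (h * b) * tail F h⁻¹) := by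
    rw [integral_add (integrable_const _) (by fun_prop), integral_add (by fun_prop) (by fun_prop),
      integral_add (by fun_prop) (by fun_prop), integral_const_mul, integral_const_mul,
      integral_const_mul, integral_indicator hDm, integral_indicator hDm,
      integral_indicator measurableSet_Ioi]
    simp [truncMean, mu2, tail, hD]
  rw [← hrhs]
  refine integral_mono_of_nonneg (Eventually.of_forall fun x =>
    Set.indicator_nonneg (fun _ _ => (Real.exp_pos _).le) x) (by fun_prop)
    (Eventually.of_forall fun x => ?_)
  have e3 : 0 ≤ Real.exp (h * b) * (Set.Ioi h⁻¹).indicator (fun _ => (1 : ℝ)) x :=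
    mul_nonneg (Real.exp_pos _).le (Set.indicator_nonneg (fun _ _ => zero_le_one) x)
  dsimp only
  by_cases hxD : x ∈ D
  · simp only [Set.indicator_of_mem hxD]
    by_cases hxb : x ≤ b
    · rw [Set.indicator_of_mem (by exact hxb)]
      by_cases hxh : h⁻¹ < x
      · rw [Set.indicator_of_mem (by exact hxh)]
        have hx0 : 0 < x := (inv_pos.2 hh).trans hxh
        have : Real.exp (h * x) ≤ Real.exp (h * b) :=
          Real.exp_le_exp.2 (mul_le_mul_of_nonneg_left hxb hh.le)
        have : 0 < h * x := mul_pos hh hx0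
        have : 0 ≤ h ^ 2 * x ^ 2 := by positivity
        linarith
      · have hx1 : h * x ≤ 1 := by
          rw [mul_comm, ← le_div_iff₀ hh, one_div]; exact not_lt.1 hxh
        have := exp_le_one_add_add_sq hx1
        linarith [mul_pow h x 2]
    · rw [Set.indicator_of_notMem (by exact hxb)]
      -- The left side is 0 and `1 + u + u ^ 2` is positive for every `u`.
      nlinarith [sq_nonneg (h * x + 1), sq_nonneg (h * x)]
  · simp only [Set.indicator_of_notMem hxD]
    by_cases hxb : x ≤ b
    · rw [Set.indicator_of_mem (by exact hxb)]
      have hx0 : x < 0 := by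
        by_contra! h0
        exact hxD (by simpa [hD, abs_of_nonneg h0] using hxb.trans hbs)
      have : Real.exp (h * x) ≤ 1 :=
        Real.exp_le_one_iff.2 (mul_nonpos_of_nonneg_of_nonpos hh.le hx0.le)
      linarith
    · rw [Set.indicator_of_notMem (by exact hxb)]
      linarith

theorem measureReal_lt_partialSum_le_exp {Ω : Type*} [MeasurableSpace Ω] {P : Measure Ω}
    [IsProbabilityMeasure P] {F : Measure ℝ} [IsProbabilityMeasure F] {X : ℕ → Ω → ℝ}
    (hindep : iIndepFun X P) (hlaw : ∀ i, HasLaw (X i) F P) (n : ℕ) {s b h : ℝ} (hh : 0 < h)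
    (hs : 0 ≤ s) (hbs : b ≤ s) :
    P.real {ω | s < partialSum X n ω ∧ ∀ i < n, X i ω ≤ b}
      ≤ Real.exp (-(h * s) +
        n * (h * truncMean F s + h ^ 2 * mu2 F s + Real.exp (h * b) * tail F h⁻¹)) := by
  refine (measureReal_lt_partialSum_le_exp_mul_pow hindep hlaw n hh.le).trans ?_
  rw [Real.exp_add, Real.exp_nat_mul]
  refine mul_le_mul_of_nonneg_left (pow_le_pow_left₀ (integral_nonneg fun x =>
    Set.indicator_nonneg (fun _ _ => (Real.exp_pos _).le) x) ?_ n) (Real.exp_pos _).le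
  refine (integral_indicator_Iic_exp_le F hh hs hbs).trans ?_
  rw [add_comm]
  exact Real.add_one_le_exp _

/-! ### The lower bound for the ratio. -/

theorem eventually_mul_le_ratio {Ω : Type*} [MeasurableSpace Ω]
    {P : Measure Ω} [IsProbabilityMeasure P] {F : Measure ℝ} [IsProbabilityMeasure F]
    {X : ℕ → Ω → ℝ} {t : ℕ → ℝ} (hindep : iIndepFun X P) (hlaw : ∀ i, HasLaw (X i) F P)
    (hpos : ∀ x, 0 < tail F x) (ht : Tendsto t atTop atTop)
    (hprob : TendstoInMeasure P (fun n ω => partialSum X n ω / t n) atTop (fun _ => 0))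
    {l c η : ℝ} (hl : 1 < l) (hc : ∀ᶠ x in atTop, c * tail F x ≤ tail F (l * x))
    (hη : 0 < η) (hη1 : η ≤ 1) :
    ∀ᶠ n : ℕ in atTop, ∀ s, t n ≤ s → (1 - η) * c ≤ ratio P F X n s := by
  filter_upwards [eventually_mul_absTail_le hindep hlaw ht hprob (zero_lt_one.trans hl)
      (half_pos hη),
    eventually_measureReal_abs_partialSum_sub_le hlaw ht hprob (sub_pos.2 hl) (half_pos hη),
    eventually_forall_ge_of_eventually hc ht, eventually_gt_atTop 0] with n h1 h2 h3 hn s hs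
  have hn' : (0 : ℝ) < n := Nat.cast_pos.2 hn
  have key := mul_sub_le_measureReal_of_big_jump hindep hlaw (measurableSet_Ioi (a := l * s))
    (measurableSet_abs_le ((l - 1) * s)) le_rfl
    (fun i _ => one_sub_le_measureReal_abs_le (h2 s hs i))
    (E := {ω | s < partialSum X n ω}) (fun ω i _ hA hB => by
      simp only [Set.mem_ofPred_eq, Set.mem_Ioi] at hA hB ⊢
      linarith [(abs_le.1 hB).1])
  change n * tail F (l * s) * (1 - η / 2 - n * tail F (l * s)) ≤ _ at key
  have h4 := (mul_le_mul_of_nonneg_left (tail_le_absTail F (l * s)) hn'.le).trans (h1 s hs)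
  rw [ratio, le_div_iff₀ (mul_pos hn' (hpos s))]
  refine le_trans ?_ key
  calc (1 - η) * c * (n * tail F s) = n * (c * tail F s) * (1 - η) := by ring
    _ ≤ n * tail F (l * s) * (1 - η) := by
        have := sub_nonneg.2 hη1
        have := h3 s hs
        gcongr
    _ ≤ n * tail F (l * s) * (1 - η / 2 - n * tail F (l * s)) := by
        refine mul_le_mul_of_nonneg_left ?_ (mul_nonneg hn'.le (tail_nonneg F _))
        linarith

/-! ### The upper bound for the ratio. -/

/-- Potter-type bound: each division of the argument by `l` costs a bounded factor, and about `log y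
/ log l` divisions are needed, so the loss is polynomial in `y`. -/
theorem exists_tail_div_le_mul_pow {F : Measure ℝ} [IsProbabilityMeasure F]
    (hpos : ∀ x, 0 < tail F x) {l c : ℝ} (hl : 1 < l) (hc0 : 0 < c)
    (hc : ∀ᶠ x in atTop, c * tail F x ≤ tail F (l * x)) :
    ∃ C : ℝ, 0 < C ∧ ∃ p : ℕ, ∀ y, 1 ≤ y → ∀ s, 0 ≤ s → tail F (s / y) ≤ C * y ^ p * tail F s := by
  have hl0 : 0 < l := zero_lt_one.trans hl
  obtain ⟨x₀, hx₀⟩ := eventually_atTop.1 hc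
  obtain ⟨c', hc', hstep⟩ : ∃ c' > 0, ∀ x, c' * tail F x ≤ tail F (l * x) := by
    -- Shrinking the constant extends the inequality below `x₀`, where `tail F x ≤ 1` and `tail F (l
    -- * x) ≥ tail F (l * x₀)`.
    refine ⟨min c (tail F (l * x₀)), lt_min hc0 (hpos _), fun x => ?_⟩
    rcases le_total x₀ x with h | h
    · exact (mul_le_mul_of_nonneg_right (min_le_left _ _) (tail_nonneg F x)).trans (hx₀ x h)
    · calc min c (tail F (l * x₀)) * tail F x ≤ tail F (l * x₀) * 1 :=
            mul_le_mul (min_le_right _ _) (tail_le_one F x) (tail_nonneg F x) (tail_nonneg F _)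
        _ ≤ tail F (l * x) := by
            rw [mul_one]; exact tail_antitone F (mul_le_mul_of_nonneg_left h hl0.le)
  obtain ⟨p, hp⟩ := pow_unbounded_of_one_lt c'⁻¹ hl
  have hiter : ∀ (k : ℕ) (s : ℝ), tail F (s / l ^ k) ≤ (l ^ p) ^ k * tail F s := by
    intro k
    induction k with
    | zero => simp
    | succ k ih =>
      intro s
      have h1 : tail F (s / l ^ (k + 1)) ≤ c'⁻¹ * tail F (s / l ^ k) := by
        rw [← div_eq_inv_mul, le_div_iff₀' hc']
        have h2 : l * (s / l ^ (k + 1)) = s / l ^ k := by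
          rw [pow_succ]
          field_simp
        exact h2 ▸ hstep (s / l ^ (k + 1))
      calc tail F (s / l ^ (k + 1)) ≤ c'⁻¹ * tail F (s / l ^ k) := h1
        _ ≤ l ^ p * ((l ^ p) ^ k * tail F s) :=
            mul_le_mul hp.le (ih s) (tail_nonneg F _) (by positivity)
        _ = (l ^ p) ^ (k + 1) * tail F s := by ring
  refine ⟨l ^ p, by positivity, p, fun y hy s hs => ?_⟩
  obtain ⟨k, hk1, hk2⟩ := exists_nat_pow_near hy hl
  calc tail F (s / y) ≤ tail F (s / l ^ (k + 1)) :=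
        tail_antitone F (div_le_div_of_nonneg_left hs (by positivity) hk2.le)
    _ ≤ (l ^ p) ^ (k + 1) * tail F s := hiter _ _
    _ = l ^ p * (l ^ k) ^ p * tail F s := by ring
    _ ≤ l ^ p * y ^ p * tail F s := by
        have := tail_nonneg F s
        gcongr

/-- If no summand exceeds `u` but `X i > b`, the remaining sum exceeds `s - u`, and this is
independent of `X i`; hence the product `η * tail F b`. -/
theorem measureReal_lt_partialSum_le {Ω : Type*} [MeasurableSpace Ω] {P : Measure Ω}
    [IsProbabilityMeasure P] {F : Measure ℝ} {X : ℕ → Ω → ℝ}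
    (hindep : iIndepFun X P) (hlaw : ∀ i, HasLaw (X i) F P) {n : ℕ} {s b u η : ℝ}
    (hη : ∀ i < n, P.real {ω | s - u < |partialSum X n ω - X i ω|} ≤ η) :
    P.real {ω | s < partialSum X n ω} ≤ n * tail F u + n * (η * tail F b) +
      P.real {ω | s < partialSum X n ω ∧ ∀ i < n, X i ω ≤ b} := by
  have hX : ∀ i, AEMeasurable (X i) P := fun i => (hlaw i).aemeasurable
  set U := ⋃ i ∈ Finset.range n, {ω | u < X i ω}
  set V := ⋃ i ∈ Finset.range n, (fun ω => partialSum X n ω - X i ω) ⁻¹' {y | s - u < |y|} ∩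
    X i ⁻¹' Set.Ioi b
  set W := {ω | s < partialSum X n ω ∧ ∀ i < n, X i ω ≤ b}
  have hU : P.real U ≤ n * tail F u := by
    refine (measureReal_biUnion_finset_le _ _).trans_eq ?_
    simp [HasLaw.measureReal_lt (hlaw _)]
  have hV : P.real V ≤ n * (η * tail F b) := by
    refine (measureReal_biUnion_finset_le _ _).trans ?_
    rw [← nsmul_eq_mul, ← Finset.card_range n, ← Finset.sum_const, Finset.card_range]
    refine Finset.sum_le_sum fun i hi => ?_
    have hi' := Finset.mem_range.1 hi
    rw [IndepFun.measureReal_inter_preimage (indepFun_partialSum_sub hindep hX hi')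
      (measurableSet_lt_abs _) measurableSet_Ioi,
      HasLaw.measureReal_preimage (hlaw i) measurableSet_Ioi]
    exact mul_le_mul_of_nonneg_right (hη i hi') measureReal_nonneg
  have hsub : {ω | s < partialSum X n ω} ⊆ U ∪ V ∪ W := by
    intro ω hω
    by_contra hcon
    simp only [U, V, W, Set.mem_union, Set.mem_iUnion, Finset.mem_range, Set.mem_inter_iff,
      Set.mem_preimage, Set.mem_ofPred_eq, Set.mem_Ioi, not_or, not_exists, not_and, not_lt,
      not_forall, not_le] at hcon hω
    obtain ⟨⟨h1, h2⟩, h3⟩ := hcon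
    obtain ⟨i, hi, hb⟩ := h3 hω
    refine absurd (h2 i hi ?_) (not_le.2 hb)
    linarith [h1 i hi, le_abs_self (partialSum X n ω - X i ω)]
  calc P.real {ω | s < partialSum X n ω} ≤ P.real (U ∪ V ∪ W) :=
        measureReal_mono hsub (measure_ne_top _ _)
    _ ≤ P.real U + P.real V + P.real W :=
        (measureReal_union_le _ _).trans (by gcongr; exact measureReal_union_le _ _)
    _ ≤ _ := by gcongr

theorem eventually_ratio_le {Ω : Type*} [MeasurableSpace Ω]
    {P : Measure Ω} [IsProbabilityMeasure P] {F : Measure ℝ} [IsProbabilityMeasure F]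
    {X : ℕ → Ω → ℝ} {t : ℕ → ℝ} (hindep : iIndepFun X P) (hlaw : ∀ i, HasLaw (X i) F P)
    (hpos : ∀ x, 0 < tail F x) (ht : Tendsto t atTop atTop)
    (hprob : TendstoInMeasure P (fun n ω => partialSum X n ω / t n) atTop (fun _ => 0))
    (hmom : ∀ η : ℝ, 0 < η → ∀ᶠ n : ℕ in atTop, ∀ s, t n ≤ s →
      n * aFun F n s * mu2 F s / s ^ 2 ≤ η)
    {l c η : ℝ} (hl : 1 < l) (hc0 : 0 < c) (hc : ∀ᶠ x in atTop, c * tail F x ≤ tail F (l * x))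
    (hη : 0 < η) :
    ∀ᶠ n : ℕ in atTop, ∀ s, t n ≤ s → ratio P F X n s ≤ c⁻¹ + η := by
  have hl0 : 0 < l := zero_lt_one.trans hl
  obtain ⟨C, hC, p, hCp⟩ := exists_tail_div_le_mul_pow hpos hl hc0 hc
  have hG : ∀ η : ℝ, 0 < η → ∀ᶠ n : ℕ in atTop, ∀ s, t n ≤ s → n * absTail F s ≤ η := by
    intro η hη
    simpa using eventually_mul_absTail_le hindep hlaw ht hprob one_pos hη
  obtain ⟨M₁, hM₁⟩ : ∃ M₁ : ℝ, ∀ a, M₁ ≤ a → C * (2 * a) ^ p * Real.exp (-(a / 2)) ≤ 1 := by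
    have h1 : Tendsto (fun a : ℝ => C * 4 ^ p * ((a / 2) ^ p * Real.exp (-(a / 2)))) atTop
        (𝓝 (C * 4 ^ p * 0)) :=
      ((Real.tendsto_pow_mul_exp_neg_atTop_nhds_zero p).comp
        (tendsto_id.atTop_div_const two_pos)).const_mul _
    rw [mul_zero] at h1
    refine (eventually_atTop.1 (h1.eventually_le_const one_pos)).imp fun M hM a ha => ?_
    refine le_of_eq_of_le ?_ (hM a ha)
    rw [show 2 * a = 4 * (a / 2) by ring, mul_pow]
    ring
  obtain ⟨M₂, hM₂⟩ : ∃ M₂ : ℝ, ∀ a, M₂ ≤ a → Real.exp (1 - a / 2) ≤ η / 2 := by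
    refine ⟨2 * (1 - Real.log (η / 2)), fun a ha => ?_⟩
    rw [← Real.le_log_iff_exp_le (by positivity)]
    linarith
  have hc' : ∀ᶠ x in atTop, c * tail F (x / l) ≤ tail F x := by
    filter_upwards [(tendsto_id.atTop_div_const hl0).eventually hc] with x hx
    simpa [mul_div_cancel₀ _ hl0.ne'] using hx
  have hl1 : 0 < 1 - l⁻¹ := sub_pos.2 (inv_lt_one_of_one_lt₀ hl)
  -- Chosen to absorb the loss `C * 8 ^ p` in comparing `tail F (s / 8)` with `tail F s`.
  set η' : ℝ := η / (2 * (C * 8 ^ p)) with hη'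
  have hη'0 : 0 < η' := by positivity
  filter_upwards [eventually_measureReal_abs_partialSum_sub_le hlaw ht hprob hl1 hη'0,
    eventually_forall_ge_of_eventually hc' ht, eventually_gt_atTop 0,
    ht.eventually_gt_atTop 0, eventually_le_aFun hpos hG 1, eventually_le_aFun hpos hG M₁,
    eventually_le_aFun hpos hG M₂, hmom (1 / 1024) (by norm_num), hG (1 / 4) (by norm_num),
    eventually_measureReal_abs_partialSum_le ht hprob (show (0 : ℝ) < 1 / 8 / 2 by norm_num)
      (show (0 : ℝ) < 1 / 4 by norm_num)]
    with n h1 h2 hn htn ha1 haM₁ haM₂ hmu hGn hSn s hs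
  have hn' : (0 : ℝ) < n := Nat.cast_pos.2 hn
  have hs0 : 0 < s := htn.trans_le hs
  have hτ : 0 < n * tail F s := mul_pos hn' (hpos s)
  have hexp := exp_neg_aFun F hn (hpos s)
  replace ha1 := ha1 s hs
  replace haM₁ := haM₁ s hs
  replace haM₂ := haM₂ s hs
  replace hmu := hmu s hs
  set a := aFun F n s with ha_def
  have ha0 : 0 < a := by linarith
  -- The right side is `1 / 1024`; since `a ≥ 1`, the factor `a` can be dropped from the moment
  -- condition.
  have hmu1 : n * mu2 F s / s ^ 2 ≤ (1 / 8 / 2) ^ 2 / 4 := by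
    refine le_trans ?_ (hmu.trans_eq (by norm_num))
    gcongr
    · exact mu2_nonneg F s
    · nlinarith
  have hmean := mul_abs_truncMean_lt hindep hlaw hs0 (by norm_num) (hGn s hs) hmu1 (hSn s hs)
  have hmain := measureReal_lt_partialSum_le (b := s / 8) (u := s / l) (s := s) hindep hlaw
    (fun i _ => by
      convert h1 s hs i using 4
      field_simp)
  -- With `h = 2 * a / s` the leading term is `-2 * a`; the mean and the second moment cost at most
  -- `a / 4` each and the far tail at most 1. This leaves `exp (-a) = n * tail F s` times the small
  -- factor `exp (1 - a / 2)`.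
  have hsmall := measureReal_lt_partialSum_le_exp hindep hlaw n (b := s / 8)
    (show 0 < 2 * a / s by positivity) hs0.le (by linarith)
  have hexponent : -(2 * a / s * s) + n * (2 * a / s * truncMean F s + (2 * a / s) ^ 2 * mu2 F s +
      Real.exp (2 * a / s * (s / 8)) * tail F (2 * a / s)⁻¹) ≤ -a + (1 - a / 2) := by
    have e1 : n * (2 * a / s * truncMean F s) ≤ a / 4 := by
      calc n * (2 * a / s * truncMean F s) ≤ 2 * a / s * (n * |truncMean F s|) := by
            rw [mul_left_comm]
            gcongr
            exact le_abs_self _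
        _ ≤ 2 * a / s * (1 / 8 * s) := by gcongr
        _ = a / 4 := by field_simp; norm_num
    have e2 : n * ((2 * a / s) ^ 2 * mu2 F s) ≤ a / 4 := by
      calc n * ((2 * a / s) ^ 2 * mu2 F s) = 4 * a * (n * a * mu2 F s / s ^ 2) := by
            field_simp; ring
        _ ≤ 4 * a * (1 / 1024) := by gcongr
        _ ≤ a / 4 := by linarith
    have e3 : n * (Real.exp (2 * a / s * (s / 8)) * tail F (2 * a / s)⁻¹) ≤ 1 := by
      have h3 := hCp (2 * a) (by linarith) s hs0.le
      rw [inv_div, show 2 * a / s * (s / 8) = a / 4 by field_simp; norm_num]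
      calc n * (Real.exp (a / 4) * tail F (s / (2 * a)))
          ≤ n * (Real.exp (a / 4) * (C * (2 * a) ^ p * tail F s)) := by gcongr
        _ = C * (2 * a) ^ p * (Real.exp (a / 4) * (n * tail F s)) := by ring
        _ = C * (2 * a) ^ p * Real.exp (a / 4 + -a) := by rw [Real.exp_add, hexp]
        _ ≤ C * (2 * a) ^ p * Real.exp (-(a / 2)) := by gcongr; linarith
        _ ≤ 1 := hM₁ a haM₁
    rw [div_mul_cancel₀ _ hs0.ne', mul_add, mul_add]
    linarith
  have hthird : P.real {ω | s < partialSum X n ω ∧ ∀ i < n, X i ω ≤ s / 8}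
      ≤ n * tail F s * (η / 2) := by
    refine hsmall.trans ((Real.exp_le_exp.2 hexponent).trans ?_)
    rw [Real.exp_add, hexp]
    exact mul_le_mul_of_nonneg_left (hM₂ a haM₂) hτ.le
  have hfirst : n * tail F (s / l) ≤ n * tail F s * c⁻¹ := by
    have h3 := h2 s hs
    rw [← div_eq_mul_inv, le_div_iff₀ hc0]
    nlinarith
  have hsecond : n * (η' * tail F (s / 8)) ≤ n * tail F s * (η / 2) := by
    have h3 := hCp 8 (by norm_num) s hs0.le
    calc n * (η' * tail F (s / 8)) ≤ n * (η' * (C * 8 ^ p * tail F s)) := by gcongr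
      _ = n * tail F s * (η / 2) := by rw [hη']; field_simp
  rw [ratio, div_le_iff₀ hτ]
  linarith

/-! ### Passage to the limit `l ↓ 1`. -/

theorem antitone_lowerIndex_tail {F : Measure ℝ} [IsProbabilityMeasure F] :
    Antitone (lowerIndex (tail F)) := by
  intro l l' hl
  refine liminf_le_liminf ?_
  filter_upwards [eventually_ge_atTop 0] with x hx
  exact ENNReal.ofReal_le_ofReal (div_le_div_of_nonneg_right
    (tail_antitone F (mul_le_mul_of_nonneg_right hl hx)) (tail_nonneg F x))

theorem eventually_mul_tail_le_of_lt_lowerIndex {F : Measure ℝ} (hpos : ∀ x, 0 < tail F x)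
    {l c : ℝ} (h : ENNReal.ofReal c < lowerIndex (tail F) l) :
    ∀ᶠ x in atTop, c * tail F x ≤ tail F (l * x) := by
  filter_upwards [eventually_lt_of_lt_liminf h] with x hx
  rw [← le_div_iff₀ (hpos x)]
  exact (ENNReal.ofReal_lt_ofReal_iff'.1 hx).1.le

theorem IntermediateRegularlyVarying.exists_eventually_mul_tail_le {F : Measure ℝ}
    (hpos : ∀ x, 0 < tail F x) (h : IntermediateRegularlyVarying (tail F)) {c : ℝ} (hc : c < 1) :
    ∃ l, 1 < l ∧ ∀ᶠ x in atTop, c * tail F x ≤ tail F (l * x) := by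
  have h1 : ∀ᶠ l in 𝓝 (1 : ℝ), ∀ᶠ x in atTop, c < tail F (l * x) / tail F x :=
    (h.eventually_const_lt hc).curry
  have h2 := (h1.filter_mono nhdsWithin_le_nhds).and (self_mem_nhdsWithin (a := 1) (s := Set.Ioi 1))
  obtain ⟨l, hl, hl1⟩ := h2.exists
  refine ⟨l, hl1, hl.mono fun x hx => ?_⟩
  rw [← le_div_iff₀ (hpos x)]
  exact hx.le

/-- The strict gap between `c` and `r` pays for the error `η` in both ratio bounds. -/
theorem exists_ofReal_lt_lowerIndex {F : Measure ℝ} {c : ℝ≥0∞}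
    (hc : c < sSup (lowerIndex (tail F) '' Set.Ioi 1)) :
    ∃ r : ℝ, c.toReal < r ∧ ∃ l, 1 < l ∧ ENNReal.ofReal r < lowerIndex (tail F) l := by
  obtain ⟨_, ⟨l, hl, rfl⟩, hcl⟩ := lt_sSup_iff.1 hc
  obtain ⟨r, hr0, hr1, hr2⟩ := ENNReal.lt_iff_exists_real_btwn.1 hcl
  exact ⟨r, (ENNReal.lt_ofReal_iff_toReal_lt (hc.ne_top)).1 hr1, l, hl, hr2⟩

theorem sSup_lowerIndex_le_liminf_ratio {Ω : Type*} [MeasurableSpace Ω]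
    {P : Measure Ω} [IsProbabilityMeasure P] {F : Measure ℝ} [IsProbabilityMeasure F]
    {X : ℕ → Ω → ℝ} {t : ℕ → ℝ} (hindep : iIndepFun X P) (hlaw : ∀ i, HasLaw (X i) F P)
    (hpos : ∀ x, 0 < tail F x) (ht : Tendsto t atTop atTop)
    (hprob : TendstoInMeasure P (fun n ω => partialSum X n ω / t n) atTop (fun _ => 0)) :
    sSup (lowerIndex (tail F) '' Set.Ioi 1) ≤ liminf (fun n : ℕ => ⨅ s ∈ Set.Ici (t n),
      ENNReal.ofReal (ratio P F X n s)) atTop := by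
  refine le_of_forall_lt_imp_le_of_dense fun c hc => ?_
  obtain ⟨r, hcr, l, hl, hlr⟩ := exists_ofReal_lt_lowerIndex hc
  have hr : 0 < r := ENNReal.toReal_nonneg.trans_lt hcr
  have hη : 0 < 1 - c.toReal / r := sub_pos.2 ((div_lt_one hr).2 hcr)
  have hη1 : 1 - c.toReal / r ≤ 1 := sub_le_self _ (div_nonneg ENNReal.toReal_nonneg hr.le)
  refine le_liminf_of_le (by isBoundedDefault) ?_
  filter_upwards [eventually_mul_le_ratio hindep hlaw hpos ht hprob hl
    (eventually_mul_tail_le_of_lt_lowerIndex hpos hlr) hη hη1] with n hn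
  refine le_iInf₂ fun s hs => ?_
  have h := hn s hs
  rw [sub_sub_cancel, div_mul_cancel₀ _ hr.ne'] at h
  exact (ENNReal.le_ofReal_iff_toReal_le hc.ne_top (ENNReal.toReal_nonneg.trans h)).2 h

theorem limsup_ratio_le_inv_sSup_lowerIndex {Ω : Type*} [MeasurableSpace Ω]
    {P : Measure Ω} [IsProbabilityMeasure P] {F : Measure ℝ} [IsProbabilityMeasure F]
    {X : ℕ → Ω → ℝ} {t : ℕ → ℝ} (hindep : iIndepFun X P) (hlaw : ∀ i, HasLaw (X i) F P)
    (hpos : ∀ x, 0 < tail F x) (ht : Tendsto t atTop atTop)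
    (hprob : TendstoInMeasure P (fun n ω => partialSum X n ω / t n) atTop (fun _ => 0))
    (hmom : ∀ η : ℝ, 0 < η → ∀ᶠ n : ℕ in atTop, ∀ s, t n ≤ s →
      n * aFun F n s * mu2 F s / s ^ 2 ≤ η) :
    limsup (fun n : ℕ => ⨆ s ∈ Set.Ici (t n), ENNReal.ofReal (ratio P F X n s)) atTop ≤
      (sSup (lowerIndex (tail F) '' Set.Ioi 1))⁻¹ := by
  rw [ENNReal.le_inv_iff_le_inv]
  refine le_of_forall_lt_imp_le_of_dense fun c hc => ?_
  rw [ENNReal.le_inv_iff_le_inv]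
  rcases eq_or_ne c 0 with rfl | hc0
  · simp
  obtain ⟨r, hcr, l, hl, hlr⟩ := exists_ofReal_lt_lowerIndex hc
  have hc' : 0 < c.toReal := ENNReal.toReal_pos hc0 hc.ne_top
  have hr : 0 < r := hc'.trans hcr
  have hη : 0 < c.toReal⁻¹ - r⁻¹ := sub_pos.2 (inv_strictAnti₀ hc' hcr)
  refine limsup_le_of_le (by isBoundedDefault) ?_
  filter_upwards [eventually_ratio_le hindep hlaw hpos ht hprob hmom hl hr
    (eventually_mul_tail_le_of_lt_lowerIndex hpos hlr) hη] with n hn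
  refine iSup₂_le fun s hs => ?_
  have h := hn s hs
  rw [add_sub_cancel] at h
  refine (ENNReal.ofReal_le_ofReal h).trans_eq ?_
  rw [ENNReal.ofReal_inv_of_pos hc', ENNReal.ofReal_toReal hc.ne_top]

theorem IntermediateRegularlyVarying.tendsto_iSup_abs_ratio_sub_one {Ω : Type*}
    [MeasurableSpace Ω] {P : Measure Ω} [IsProbabilityMeasure P] {F : Measure ℝ}
    [IsProbabilityMeasure F] {X : ℕ → Ω → ℝ} {t : ℕ → ℝ}
    (hF : IntermediateRegularlyVarying (tail F)) (hindep : iIndepFun X P)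
    (hlaw : ∀ i, HasLaw (X i) F P) (hpos : ∀ x, 0 < tail F x) (ht : Tendsto t atTop atTop)
    (hprob : TendstoInMeasure P (fun n ω => partialSum X n ω / t n) atTop (fun _ => 0))
    (hmom : ∀ η : ℝ, 0 < η → ∀ᶠ n : ℕ in atTop, ∀ s, t n ≤ s →
      n * aFun F n s * mu2 F s / s ^ 2 ≤ η) :
    Tendsto (fun n : ℕ => ⨆ s ∈ Set.Ici (t n), ENNReal.ofReal |ratio P F X n s - 1|)
      atTop (𝓝 0) := by
  refine ENNReal.tendsto_nhds_zero.2 fun ε hε => ?_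
  obtain ⟨δ, hδ0, hδ1, hδε⟩ : ∃ δ : ℝ, 0 < δ ∧ δ ≤ 1 ∧ ENNReal.ofReal δ ≤ ε := by
    -- The cap at 1 handles `ε = ∞`.
    refine ⟨(min ε 1).toReal, ENNReal.toReal_pos (lt_min hε one_pos).ne' (by simp), ?_, ?_⟩
    · exact ENNReal.toReal_mono ENNReal.one_ne_top (min_le_right _ _)
    · rw [ENNReal.ofReal_toReal (by simp)]; exact min_le_left _ _
  obtain ⟨l, hl, hlc⟩ := hF.exists_eventually_mul_tail_le hpos
    (show 1 - δ / 2 < 1 by linarith)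
  obtain ⟨l', hl', hlc'⟩ := hF.exists_eventually_mul_tail_le hpos
    (show (1 + δ / 2)⁻¹ < 1 from inv_lt_one_of_one_lt₀ (by linarith))
  filter_upwards [eventually_mul_le_ratio hindep hlaw hpos ht hprob hl hlc (half_pos hδ0)
      (by linarith),
    eventually_ratio_le hindep hlaw hpos ht hprob hmom hl' (by positivity) hlc' (half_pos hδ0)]
    with n h1 h2
  refine iSup₂_le fun s hs => (ENNReal.ofReal_le_ofReal ?_).trans hδε
  have h1' := h1 s hs
  have h2' := h2 s hs
  rw [inv_inv] at h2'
  exact abs_le.2 ⟨by nlinarith, by linarith⟩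

end LargeDev

theorem theorem3p2 {Ω : Type*} [MeasurableSpace Ω] (P : Measure Ω) [IsProbabilityMeasure P]
    (F : Measure ℝ) [IsProbabilityMeasure F] (X : ℕ → Ω → ℝ) (t : ℕ → ℝ)
    -- `X 0, X 1, ...` are independent with common law `F`
    (hindep : iIndepFun X P) (hlaw : ∀ i, HasLaw (X i) F P)
    -- the denominators in the ratios and the logarithm in `ψ` make sense
    (hpos : ∀ x, 0 < LargeDev.tail F x)
    (ht : Tendsto t atTop atTop)
    (hdom : LargeDev.DominatedVarying (LargeDev.absTail F))
    (hprob : TendstoInMeasure P (fun n ω => LargeDev.partialSum X n ω / t n) atTop (fun _ => 0))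
    (hmom : limsup (fun n : ℕ => ⨆ s ∈ Set.Ici (t n),
      ((n * LargeDev.aFun F n s * LargeDev.mu2 F s / s ^ 2 : ℝ) : EReal)) atTop = 0) :
    (∃ (ℓ : ℝ≥0∞) (γ : EReal),
      Tendsto (LargeDev.lowerIndex (LargeDev.tail F)) (𝓝[>] 1) (𝓝 ℓ) ∧
      γ = -ENNReal.log ℓ ∧
      EReal.exp (-γ) ≤ liminf (fun n : ℕ => ⨅ s ∈ Set.Ici (t n),
        ENNReal.ofReal (LargeDev.ratio P F X n s)) atTop ∧
      liminf (fun n : ℕ => ⨅ s ∈ Set.Ici (t n),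
        ENNReal.ofReal (LargeDev.ratio P F X n s)) atTop ≤
      limsup (fun n : ℕ => ⨆ s ∈ Set.Ici (t n),
        ENNReal.ofReal (LargeDev.ratio P F X n s)) atTop ∧
      limsup (fun n : ℕ => ⨆ s ∈ Set.Ici (t n),
        ENNReal.ofReal (LargeDev.ratio P F X n s)) atTop ≤ EReal.exp γ) ∧
    (LargeDev.IntermediateRegularlyVarying (LargeDev.tail F) →
      Tendsto (fun n : ℕ => ⨆ s ∈ Set.Ici (t n),
        ENNReal.ofReal |LargeDev.ratio P F X n s - 1|) atTop (𝓝 0)) := by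

  have hmom' := fun (η : ℝ) (hη : 0 < η) =>
    LargeDev.eventually_forall_le_of_limsup_iSup_eq_zero hmom hη
  -- By monotonicity, `ℓ` is the supremum of the lower index over `l > 1`.
  refine ⟨⟨_, _, LargeDev.antitone_lowerIndex_tail.tendsto_nhdsGT 1, rfl, ?_, ?_, ?_⟩,
    fun hF => hF.tendsto_iSup_abs_ratio_sub_one hindep hlaw hpos ht hprob hmom'⟩
  · rw [neg_neg, ENNReal.exp_log]
    exact LargeDev.sSup_lowerIndex_le_liminf_ratio hindep hlaw hpos ht hprob
  · refine (liminf_le_liminf (Eventually.of_forall fun n => ?_)).trans liminf_le_limsup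
    exact (iInf₂_le (t n) Set.self_mem_Ici).trans
      (le_iSup₂ (f := fun s (_ : s ∈ Set.Ici (t n)) =>
        ENNReal.ofReal (LargeDev.ratio P F X n s)) (t n) Set.self_mem_Ici)
  · rw [EReal.exp_neg, ENNReal.exp_log]
    exact LargeDev.limsup_ratio_le_inv_sSup_lowerIndex hindep hlaw hpos ht hprob hmom'
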